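/- Let $\bar n,u,k,\bar d,l,\alpha,\beta$ be nonnegative integers, put $\bar k=\lfloor k/u\rfloor$ and $u_0=k-\bar k u$, and assume $0\le l<u$, $k\le \bar n u$ and $\bar d<\bar k$ (so $k\ge u$). Consider a rack-aware storage system of $\bar n$ racks with $u$ nodes each. A file of $B$ symbols over a finite alphabet is stored so that each node stores $\alpha$ symbols and, at every time, any $k$ nodes can retrieve the file. Nodes fail one at a time, arbitrarily often. When a node of rack $e$ fails, it is replaced by a node whose $\alpha$ symbols are a function of the contents of any $l$ surviving nodes of rack $e$ and of $\beta$ symbols received from each of any $\bar d$ helper racks other than $e$, where the $\beta$ symbols sent by a helper rack are a function of the contents of all its nodes; the other nodes are unchanged. (The replacement need not equal the lost node, it only has to keep the file retrievable from any $k$ nodes.) Then the maximum possible file size is $$B^*=(\bar k l+\min\{u_0,l\})\,\alpha+(u-l)\sum_{i=1}^{\bar d}\min\{i\beta,\alpha\}.$$ This holds in each of the following senses. (1) $B^*$ is the largest $B$ such that for every finite sequence of repairs, known in advance, there are a finite alphabet with at least two symbols and coding functions that keep a file of $B$ symbols retrievable from any $k$ nodes at all times. (2) $B^*$ is the largest $B$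 such that over one finite alphabet with at least two symbols a file of $B$ symbols can be kept retrievable from any $k$ nodes forever, when the repairs are not known in advance. (3) $B^*$ is the minimum of $\mathrm{MinCut}(S,C)$ over all data collectors $C$ in the information flow graphs of all finite sequences of repairs. In such a graph the source $S$ is joined by edges of capacity $\infty$ to the 'in' vertices of the $n=\bar n u$ original nodes; the 'in' vertex of each original or replacement node is joined to its 'out' vertex by an edge of capacity $\alpha$; the 'in' vertex of a replacement node receives edges of capacity $\infty$ from the 'out' vertices of its $l$ local helpers and one edge of capacity $\beta$ from each of its $\bar d$ helper racks, namely from a vertex to which all current nodes of that rack are joined by edges of capacity $\infty$; at each repair the nodes that are not replaced are copied by edges of capacity $\infty$; and $C$ is joined by edges of capacity $\infty$ from $k$ nodes that are present at one time. -/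

import Mathlib

namespace RackStorage

/-- The parameters of a rack-aware storage system: `nbar` racks of `u` nodes each, every node
stores `α` symbols, any `k` nodes can retrieve the file, and a failed node is repaired from `l`
surviving nodes of its own (host) rack and from `dbar` helper racks that send `β` symbols each. -/
structure Params where
  nbar : ℕ
  u : ℕ
  k : ℕ
  dbar : ℕ
  l : ℕ
  α : ℕ
  β : ℕ

/-- `⌊k / u⌋`. -/
def Params.kbar (P : Params) : ℕ := P.k / P.u

/-- `k - ⌊k / u⌋ u`. -/
def Params.u0 (P : Params) : ℕ := P.k - P.kbar * P.u

/-- The node `(e, g)` is the `g`-th node of rack `e`. -/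
abbrev Params.Node (P : Params) : Type := Fin P.nbar × Fin P.u

/-- A repair event: the node `(rack, pos)` fails and is replaced with the help of the `l` surviving
nodes `(rack, g)`, `g ∈ localHelpers`, and of the `dbar` racks in `helperRacks`. -/
structure Repair (P : Params) where
  rack : Fin P.nbar
  pos : Fin P.u
  localHelpers : Finset (Fin P.u)
  helperRacks : Finset (Fin P.nbar)
  pos_notMem : pos ∉ localHelpers
  card_localHelpers : localHelpers.card = P.l
  rack_notMem : rack ∉ helperRacks
  card_helperRacks : helperRacks.card = P.dbar

/-- The node that fails and is replaced. -/
def Repair.node {P : Params} (r : Repair P) : P.Node := (r.rack, r.pos)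

/-! ### Storage codes -/

/-- What the nodes store, as a function of the file: the file consists of `B` symbols of the
alphabet `A`, and every node stores `α` symbols. -/
abbrev Contents (P : Params) (A : Type) (B : ℕ) : Type :=
  P.Node → (Fin B → A) → (Fin P.α → A)

/-- Any `k` nodes can retrieve the file. -/
def Retrievable {P : Params} {A : Type} {B : ℕ} (s : Contents P A B) : Prop :=
  ∀ K : Finset P.Node, K.card = P.k →
    ∃ dec : (K → Fin P.α → A) → (Fin B → A), ∀ m, dec (fun v => s v m) = m

/-- The contents `s'` can arise from the contents `s` by the repair `r`: every helper rack uploads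
`β` symbols, computed from the data of all its nodes; the replacement node stores `α` symbols
computed from these and from the data of the local helpers; the other nodes are unchanged. -/
def RepairStep {P : Params} {A : Type} {B : ℕ}
    (s : Contents P A B) (r : Repair P) (s' : Contents P A B) : Prop :=
  (∀ v, v ≠ r.node → s' v = s v) ∧
  ∃ (upload : r.helperRacks → (Fin P.u → Fin P.α → A) → (Fin P.β → A))
    (gen : (r.localHelpers → Fin P.α → A) → (r.helperRacks → Fin P.β → A) → (Fin P.α → A)),
    ∀ m, s' r.node m =
      gen (fun g => s (r.rack, g) m) (fun h => upload h (fun g => s (h, g) m))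

/-- Files of `B` symbols can be stored against every finite sequence of repairs that is known in
advance: over some finite alphabet there are initial contents and coding functions for the
successive repairs such that at every time any `k` nodes can retrieve the file. That is, `B`
symbols can be multicast to all data collectors of every information flow graph. -/
def AttainableOffline (P : Params) (B : ℕ) : Prop :=
  ∀ (T : ℕ) (r : Fin T → Repair P),
    ∃ (A : Type) (_ : Finite A) (_ : Nontrivial A) (s : Fin (T + 1) → Contents P A B),
      (∀ t, Retrievable (s t)) ∧ ∀ t : Fin T, RepairStep (s t.castSucc) (r t) (s t.succ)

/-- Files of `B` symbols can be stored forever, against repairs that are not known in advance, over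
one finite alphabet: there is a nonempty family `S` of contents from each of which any `k` nodes can
retrieve the file, and in which every repair can be answered by contents in `S` again. -/
def AttainableOnline (P : Params) (B : ℕ) : Prop :=
  ∃ (A : Type) (_ : Finite A) (_ : Nontrivial A) (S : Set (Contents P A B)),
    S.Nonempty ∧ (∀ s ∈ S, Retrievable s) ∧
      ∀ s ∈ S, ∀ r : Repair P, ∃ s' ∈ S, RepairStep s r s'

/-! ### Information flow graphs -/

/-- The vertices of the information flow graph of a history of `T` repairs. -/
inductive Vertex (P : Params) (T : ℕ) : Type
  /-- the source `S` of the file -/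
  | source
  /-- the 'in' vertex of an original node -/
  | origIn (v : P.Node)
  /-- the 'in' vertex of the node that is placed by the `t`-th repair -/
  | newIn (t : Fin T)
  /-- the 'out' vertex of node `v` after the first `t` repairs -/
  | out (t : Fin (T + 1)) (v : P.Node)
  /-- the vertex of helper rack `h` at which its upload to the `t`-th repair is computed -/
  | gate (t : Fin T) (h : Fin P.nbar)
  /-- the data collector that connects to the nodes in `K` after the first `t` repairs -/
  | collector (t : Fin (T + 1)) (K : Finset P.Node)
  deriving DecidableEq, Fintype

open Classical in
/-- The capacities of the edges of the information flow graph (`0` where there is no edge). -/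
noncomputable def capacity {P : Params} {T : ℕ} (r : Fin T → Repair P) :
    Vertex P T → Vertex P T → ℕ∞
  -- the file flows to the original nodes, which store `α` symbols each
  | .source, .origIn _ => ⊤
  | .origIn v, .out t w => if t = 0 ∧ w = v then (P.α : ℕ∞) else 0
  -- a replacement node reads the local helpers, and `β` symbols from each helper rack
  | .out t w, .newIn t' =>
      if t = t'.castSucc ∧ w.1 = (r t').rack ∧ w.2 ∈ (r t').localHelpers then ⊤ else 0
  | .out t w, .gate t' h =>
      if t = t'.castSucc ∧ h ∈ (r t').helperRacks ∧ w.1 = h then ⊤ else 0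
  | .gate t h, .newIn t' => if t = t' ∧ h ∈ (r t').helperRacks then (P.β : ℕ∞) else 0
  -- a replacement node stores `α` symbols
  | .newIn t, .out t' w => if t' = t.succ ∧ w = (r t).node then (P.α : ℕ∞) else 0
  -- the nodes that are not replaced are copied
  | .out t w, .out t' w' =>
      if ∃ i : Fin T, t = i.castSucc ∧ t' = i.succ ∧ w' = w ∧ w ≠ (r i).node then ⊤ else 0
  -- a data collector reads the nodes that it connects to
  | .out t w, .collector t' K => if t = t' ∧ w ∈ K then ⊤ else 0
  | _, _ => 0

/-- The minimum capacity of a cut that separates `y` from `x` in a finite network. -/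
noncomputable def minCut {V : Type} [Fintype V] [DecidableEq V] (cap : V → V → ℕ∞) (x y : V) :
    ℕ∞ :=
  ⨅ (W : Finset V) (_ : x ∈ W ∧ y ∉ W), ∑ a ∈ W, ∑ b ∈ Wᶜ, cap a b

/-- The min-cuts between the source and the data collectors that connect to `k` nodes, over all
information flow graphs. -/
noncomputable def minCuts (P : Params) : Set ℕ∞ :=
  {c | ∃ (T : ℕ) (r : Fin T → Repair P) (t : Fin (T + 1)) (K : Finset P.Node), K.card = P.k ∧
    c = minCut (capacity r) Vertex.source (Vertex.collector t K)}

end RackStorage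

/-! The three claims follow from a cycle of inequalities: an online code attains `P.fileSize`, an
online code yields offline codes, an offline code is bounded by every cut, and one history has a cut
of value at most `P.fileSize`.

The code is linear over a prime field with more elements than there are sets of nodes. Every node
stores `α` functionals of the file, and uploads and replacements are chosen generically,
simultaneously with respect to the spans of all sets of nodes. What survives arbitrarily many
repairs is the invariant `Robust`: the span of a set either is everything or has dimension at least
the `potential` of some larger set. The potential charges `α` for each of up to `l` nodes in a rack
and a smaller weight for the excess nodes, a weight that drops as racks become full, since a full
rack can compute its uploads for free. By genericity, a replacement either adds `α` dimensions or
makes its `l` local helpers and all uploads available; `exists_uploads` shows that each upload in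
turn adds `β` dimensions or reveals its whole rack. In both cases the gain covers the growth of the
potential (`Robust.exists_repair`). Since `k` nodes have potential at least `P.fileSize`
(`fileSize_le_potential`), they always determine the file.

For the converse, the symbols that cross a cut determine what a data collector reads
(`le_minCut_of_repairStep`). In `worstRepair`, the nodes at positions at least `l` are replaced rack
by rack with help from earlier racks, so a new node in rack `e` brings only `P.weight e` new symbols
(`exists_mem_minCuts_le`). -/

namespace RackStorage

/-! ### Generic vectors over large fields -/

section Generic

variable {F E : Type*} [Field F] [AddCommGroup E] [Module F E]

/-- Over a large field a subspace has a vector that lies in no member of a finite family of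
subspaces, except in those that contain the whole subspace. -/
theorem exists_generic_vector {ι : Type*} [Fintype ι] (hF : (Fintype.card ι : ℕ∞) < ENat.card F)
    (V : Submodule F E) (W : ι → Submodule F E) :
    ∃ x ∈ V, ∀ i, x ∈ W i → V ≤ W i := by
  classical
  -- Members that contain `V` impose no condition; replacing them by `⊥` leaves only proper
  -- subspaces of a nonzero `V`.
  have h := Submodule.iUnion_ssubset_of_forall_ne_top_of_card_lt (K := F) (M := V) Finset.univ
    (fun i => if V ≤ W i then ⊥ else (W i).comap V.subtype)
  by_cases hV : V = ⊥
  · exact ⟨0, V.zero_mem, fun i _ => by simp [hV]⟩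
  have hne : ∀ i, (if V ≤ W i then ⊥ else (W i).comap V.subtype) ≠ (⊤ : Submodule F V) := by
    intro i
    split_ifs with hi
    · intro hbot
      apply hV
      rw [← Submodule.subsingleton_iff_eq_bot, ← Submodule.subsingleton_iff F]
      exact subsingleton_of_bot_eq_top hbot
    · rwa [Ne, Submodule.comap_subtype_eq_top]
  have h := h hne (by simpa using hF)
  obtain ⟨-, x, -, hx⟩ := Set.ssubset_iff_exists.1 h
  refine ⟨x, x.2, fun i hi => ?_⟩
  by_contra hVi
  apply hx
  simp only [Set.mem_iUnion]
  exact ⟨i, Finset.mem_univ i, by simpa [hVi] using hi⟩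

variable [FiniteDimensional F E]

/-- A family of `b` generic vectors of a subspace `V` raises the dimension of every member `W i` of
a finite family of subspaces by `b`, or joins it with all of `V`. -/
theorem exists_generic_vectors {ι : Type*} [Fintype ι]
    (hF : (Fintype.card ι : ℕ∞) < ENat.card F)
    (V : Submodule F E) (W : ι → Submodule F E) (b : ℕ) :
    ∃ x : Fin b → E, (∀ j, x j ∈ V) ∧ ∀ i,
      Module.finrank F (W i) + b ≤
        Module.finrank F (W i ⊔ Submodule.span F (Set.range x) : Submodule F E) ∨
      V ≤ W i ⊔ Submodule.span F (Set.range x) := by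
  induction b with
  | zero => exact ⟨Fin.elim0, fun j => j.elim0, fun i =>
      Or.inl (by simpa using Submodule.finrank_mono le_sup_left)⟩
  | succ b ih =>
    obtain ⟨x, hxV, hx⟩ := ih
    obtain ⟨y, hyV, hy⟩ := exists_generic_vector hF V
      (fun i => W i ⊔ Submodule.span F (Set.range x))
    refine ⟨Fin.cons y x, fun j => ?_, fun i => ?_⟩
    · induction j using Fin.cases with
      | zero => simpa using hyV
      | succ j => simpa using hxV j
    · have heq : W i ⊔ Submodule.span F (Set.range (Fin.cons y x : Fin (b + 1) → E)) =
          (W i ⊔ Submodule.span F (Set.range x)) ⊔ Submodule.span F {y} := by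
        rw [Fin.range_cons, Submodule.span_insert, sup_comm (Submodule.span F {y}), sup_assoc]
      rw [heq]
      by_cases hyi : y ∈ W i ⊔ Submodule.span F (Set.range x)
      · exact Or.inr ((hy i hyi).trans le_sup_left)
      · rcases hx i with h | h
        · left
          have hlt : W i ⊔ Submodule.span F (Set.range x) <
              (W i ⊔ Submodule.span F (Set.range x)) ⊔ Submodule.span F {y} := by
            refine lt_of_le_of_ne le_sup_left fun he => hyi ?_
            rw [he]
            exact (le_sup_right : Submodule.span F {y} ≤ _) (Submodule.mem_span_singleton_self y)
          have := Submodule.finrank_lt_finrank_of_lt hlt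
          omega
        · exact absurd (h hyV) hyi

end Generic

/-! ### The potential of a set of nodes -/

section Potential

variable {P : Params}

/-- The number of nodes of rack `e` in `A`. -/
def rackCount (A : Finset P.Node) (e : Fin P.nbar) : ℕ := (A.filter (fun v => v.1 = e)).card

/-- The racks all of whose nodes are in `A`. -/
def fullRacks (A : Finset P.Node) : Finset (Fin P.nbar) :=
  Finset.univ.filter (fun e => rackCount A e = P.u)

/-- The cost of a replaced node when `j` racks are available for free. -/
def Params.weight (P : Params) (j : ℕ) : ℕ := min P.α ((P.dbar - j) * P.β)

/-- The maximum file size. -/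
def Params.fileSize (P : Params) : ℕ :=
  (P.kbar * P.l + min P.u0 P.l) * P.α +
    (P.u - P.l) * ∑ i ∈ Finset.Icc 1 P.dbar, min (i * P.β) P.α

/-- A lower bound for the information that is contained in the nodes of `A`. -/
def potential (A : Finset P.Node) : ℕ :=
  P.α * ∑ e, min (rackCount A e) P.l +
  -- Excess nodes of incomplete racks count at the current weight; each full rack keeps the weight
  -- that was current when it was completed.
  P.weight (fullRacks A).card * ∑ e ∈ (fullRacks A)ᶜ, (rackCount A e - P.l) +
  (P.u - P.l) * ∑ j ∈ Finset.range (fullRacks A).card, P.weight j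

theorem rackCount_le (A : Finset P.Node) (e : Fin P.nbar) : rackCount A e ≤ P.u := by
  calc rackCount A e ≤ (Finset.univ.image (fun g : Fin P.u => ((e, g) : P.Node))).card := by
        apply Finset.card_le_card
        rintro ⟨a, b⟩ h
        simp only [Finset.mem_filter] at h
        simp [h.2]
    _ ≤ P.u := Finset.card_image_le.trans (by simp)

theorem sum_rackCount (A : Finset P.Node) : ∑ e, rackCount A e = A.card :=
  (Finset.card_eq_sum_card_fiberwise (f := Prod.fst) (t := Finset.univ) (by simp)).symm

theorem rackCount_insert_self {A : Finset P.Node} {v : P.Node} (hv : v ∉ A) :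
    rackCount (insert v A) v.1 = rackCount A v.1 + 1 := by
  rw [rackCount, Finset.filter_insert, if_pos rfl, Finset.card_insert_of_notMem (by simp [hv]),
    rackCount]

theorem rackCount_insert_of_ne {A : Finset P.Node} {v : P.Node} {e : Fin P.nbar} (he : e ≠ v.1) :
    rackCount (insert v A) e = rackCount A e := by
  rw [rackCount, Finset.filter_insert, if_neg he.symm, rackCount]

theorem mem_fullRacks {A : Finset P.Node} {e : Fin P.nbar} :
    e ∈ fullRacks A ↔ rackCount A e = P.u := by simp [fullRacks]

theorem mem_fullRacks_of_forall {A : Finset P.Node} {e : Fin P.nbar} (h : ∀ g, (e, g) ∈ A) :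
    e ∈ fullRacks A := by
  rw [mem_fullRacks]
  apply le_antisymm (rackCount_le A e)
  calc P.u = (Finset.univ.image (fun g : Fin P.u => ((e, g) : P.Node))).card := by
        rw [Finset.card_image_of_injective _ (fun _ _ h => by simpa using h)]; simp
    _ ≤ rackCount A e := by
        apply Finset.card_le_card
        rintro ⟨a, b⟩ hab
        simp only [Finset.mem_image, Finset.mem_univ, true_and, Prod.mk.injEq] at hab
        obtain ⟨c, rfl, rfl⟩ := hab
        simp [h]

theorem Params.weight_le (P : Params) (j : ℕ) : P.weight j ≤ P.α := min_le_left _ _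

theorem Params.weight_anti (P : Params) : Antitone P.weight := fun _ _ h =>
  min_le_min le_rfl (Nat.mul_le_mul_right _ (Nat.sub_le_sub_left h _))

theorem potential_empty (hl : P.l < P.u) : potential (∅ : Finset P.Node) = 0 := by
  have h : fullRacks (∅ : Finset P.Node) = ∅ := by
    ext e
    simp [mem_fullRacks, rackCount]
    omega
  simp [potential, h, rackCount]

/-- Adding a node whose rack has fewer than `l` nodes in `A`. -/
theorem potential_insert_of_lt (hl : P.l < P.u) {A : Finset P.Node} {v : P.Node} (hv : v ∉ A)
    (hc : rackCount A v.1 < P.l) : potential (insert v A) = potential A + P.α := by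
  have hs := rackCount_insert_self hv
  have hfull : fullRacks (insert v A) = fullRacks A := by
    ext e
    rw [mem_fullRacks, mem_fullRacks]
    by_cases he : e = v.1
    · subst he; omega
    · rw [rackCount_insert_of_ne he]
  have h1 : ∑ e, min (rackCount (insert v A) e) P.l = ∑ e, min (rackCount A e) P.l + 1 := by
    rw [← Finset.add_sum_erase _ _ (Finset.mem_univ v.1),
      ← Finset.add_sum_erase (a := v.1) _ (fun e => min (rackCount A e) P.l) (Finset.mem_univ v.1),
      Finset.sum_congr rfl (fun e he => by rw [rackCount_insert_of_ne (Finset.ne_of_mem_erase he)])]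
    omega
  have h2 : ∀ e, rackCount (insert v A) e - P.l = rackCount A e - P.l := by
    intro e
    by_cases he : e = v.1
    · subst he; omega
    · rw [rackCount_insert_of_ne he]
  simp only [potential, hfull, h1, h2]
  ring

/-- Adding a node whose rack has at least `l` nodes in `A`. -/
theorem potential_insert_of_le (hl : P.l < P.u) {A : Finset P.Node} {v : P.Node} (hv : v ∉ A)
    (hc : P.l ≤ rackCount A v.1) :
    potential (insert v A) ≤ potential A + P.weight (fullRacks A).card := by
  have hs := rackCount_insert_self hv
  have hle := rackCount_le (insert v A) v.1
  have hvf : v.1 ∈ (fullRacks A)ᶜ := by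
    rw [Finset.mem_compl, mem_fullRacks]; omega
  have h1 : ∑ e, min (rackCount (insert v A) e) P.l = ∑ e, min (rackCount A e) P.l := by
    apply Finset.sum_congr rfl
    intro e _
    by_cases he : e = v.1
    · subst he; omega
    · rw [rackCount_insert_of_ne he]
  have hrest : ∑ e ∈ (fullRacks A)ᶜ.erase v.1, (rackCount (insert v A) e - P.l) =
      ∑ e ∈ (fullRacks A)ᶜ.erase v.1, (rackCount A e - P.l) :=
    Finset.sum_congr rfl (fun e he => by rw [rackCount_insert_of_ne (Finset.ne_of_mem_erase he)])
  have hsplit := Finset.add_sum_erase _ (fun e => rackCount A e - P.l) hvf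
  by_cases hu : rackCount A v.1 + 1 = P.u
  · have hfull : fullRacks (insert v A) = insert v.1 (fullRacks A) := by
      ext e
      rw [Finset.mem_insert, mem_fullRacks, mem_fullRacks]
      by_cases he : e = v.1
      · subst he; simp [hs, hu]
      · rw [rackCount_insert_of_ne he]; simp [he]
    have hcard : (fullRacks (insert v A)).card = (fullRacks A).card + 1 := by
      rw [hfull, Finset.card_insert_of_notMem (by simpa using hvf)]
    have hcompl : (fullRacks (insert v A))ᶜ = (fullRacks A)ᶜ.erase v.1 := by
      rw [hfull, Finset.compl_insert]
    rw [potential, potential, h1, hcard, hcompl, hrest, Finset.sum_range_succ, ← hsplit]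
    -- Completing the rack freezes its `u - l` excess nodes at the old weight, and the excess nodes
    -- of the other incomplete racks are repriced at the new weight, which is no larger.
    have hw := P.weight_anti (Nat.le_succ (fullRacks A).card)
    have e1 : rackCount A v.1 - P.l + 1 = P.u - P.l := by omega
    have hw' := Nat.mul_le_mul_right
      (∑ e ∈ (fullRacks A)ᶜ.erase v.1, (rackCount A e - P.l)) hw
    rw [← e1]
    simp only [Nat.succ_eq_add_one] at hw'
    linarith
  · have hfull : fullRacks (insert v A) = fullRacks A := by
      ext e
      rw [mem_fullRacks, mem_fullRacks]
      by_cases he : e = v.1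
      · subst he; omega
      · rw [rackCount_insert_of_ne he]
    have hsplit' := Finset.add_sum_erase _ (fun e => rackCount (insert v A) e - P.l) hvf
    rw [potential, potential, h1, hfull, ← hsplit, ← hsplit', hrest, hs]
    have e1 : rackCount A v.1 + 1 - P.l = rackCount A v.1 - P.l + 1 := by omega
    rw [e1]
    apply le_of_eq
    ring

theorem potential_insert_le (hl : P.l < P.u) (A : Finset P.Node) (v : P.Node) :
    potential (insert v A) ≤ potential A + P.α := by
  by_cases hv : v ∈ A
  · rw [Finset.insert_eq_of_mem hv]; omega
  rcases lt_or_ge (rackCount A v.1) P.l with h | h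
  · exact (potential_insert_of_lt hl hv h).le
  · exact (potential_insert_of_le hl hv h).trans (Nat.add_le_add_left (P.weight_le _) _)

theorem potential_insert_le_of_helpers (hl : P.l < P.u) (A : Finset P.Node) (v : P.Node)
    (hc : P.l ≤ rackCount A v.1) {j : ℕ} (hj : j ≤ (fullRacks A).card) :
    potential (insert v A) ≤ potential A + (P.dbar - j) * P.β := by
  by_cases hv : v ∈ A
  · rw [Finset.insert_eq_of_mem hv]; omega
  · exact (potential_insert_of_le hl hv hc).trans
      (Nat.add_le_add_left ((P.weight_anti hj).trans (min_le_right _ _)) _)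

/-- A set of at least `q u + r` elements in blocks of size at most `u` has at least
`q l + min r l` elements if at most `l` are counted in each block. -/
theorem le_sum_min {ι : Type*} (s : Finset ι) (a : ι → ℕ) {u l : ℕ} (hl : l < u)
    (ha : ∀ i ∈ s, a i ≤ u) (q r : ℕ) (hr : r < u) (h : q * u + r ≤ ∑ i ∈ s, a i) :
    q * l + min r l ≤ ∑ i ∈ s, min (a i) l := by
  classical
  induction s using Finset.induction_on generalizing q r with
  | empty =>
    simp only [Finset.sum_empty] at h ⊢
    have : q = 0 := by
      by_contra hq
      have := Nat.mul_pos (Nat.pos_of_ne_zero hq) (by omega : 0 < u)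
      omega
    subst this; omega
  | insert i s hi ih =>
    rw [Finset.sum_insert hi] at h ⊢
    have hai := ha i (Finset.mem_insert_self i s)
    have ih := ih (fun j hj => ha j (Finset.mem_insert_of_mem hj))
    rcases le_or_gt (a i) r with hir | hir
    · have := ih q (r - a i) (by omega) (by omega)
      omega
    · rcases q with _ | q
      · have := ih 0 0 (by omega) (by omega)
        omega
      · have e1 : (q + 1) * u = q * u + u := by ring
        have e2 : (q + 1) * l = q * l + l := by ring
        rcases eq_or_lt_of_le hai with hu | hu
        · have := ih q r hr (by omega)
          omega
        -- One block is broken up: the new remainder is below `u` because `r < a i`.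
        · have := ih q (r + u - a i) (by omega) (by omega)
          omega

theorem kbar_mul_add_u0 (P : Params) : P.kbar * P.u + P.u0 = P.k := by
  have := Nat.div_mul_le_self P.k P.u
  rw [Params.u0, Params.kbar]; omega

theorem u0_lt (hl : P.l < P.u) : P.u0 < P.u := by
  have := kbar_mul_add_u0 P
  have h2 := Nat.div_add_mod' P.k P.u
  have h3 := Nat.mod_lt P.k (by omega : P.u > 0)
  rw [Params.kbar] at this; omega

theorem sum_Icc_eq_sum_weight (P : Params) :
    ∑ i ∈ Finset.Icc 1 P.dbar, min (i * P.β) P.α = ∑ j ∈ Finset.range P.dbar, P.weight j := by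
  refine Finset.sum_nbij' (fun i => P.dbar - i) (fun j => P.dbar - j) ?_ ?_ ?_ ?_ ?_
  · intro i hi; simp only [Finset.mem_Icc, Finset.mem_range] at *; omega
  · intro j hj; simp only [Finset.mem_Icc, Finset.mem_range] at *; omega
  · intro i hi; simp only [Finset.mem_Icc] at *; omega
  · intro j hj; simp only [Finset.mem_range] at *; omega
  · intro i hi
    simp only [Finset.mem_Icc] at hi
    rw [Params.weight, min_comm, Nat.sub_sub_self hi.2]

/-- Beyond `dbar` full racks all weights vanish, and with fewer the weights still missing from the
sum are at most the current one. The excess nodes of incomplete racks pay for these, as `dbar <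
kbar` leaves enough of them; where excess nodes are lacking, nodes charged at the higher rate `α`
take their place. -/
theorem fileSize_le_potential (hl : P.l < P.u) (hd : P.dbar < P.kbar) {A : Finset P.Node}
    (hA : P.k ≤ A.card) : P.fileSize ≤ potential A := by
  rw [Params.fileSize, sum_Icc_eq_sum_weight]
  have hk := kbar_mul_add_u0 P
  have hu0 := u0_lt hl
  have hsum := sum_rackCount A
  have hM := le_sum_min Finset.univ (rackCount A) hl (fun e _ => rackCount_le A e) P.kbar P.u0 hu0
    (by omega)
  set F := (fullRacks A).card with hF
  set w := P.weight F
  rcases le_or_gt P.dbar F with h | h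
  · have h1 : ∑ j ∈ Finset.range P.dbar, P.weight j ≤ ∑ j ∈ Finset.range F, P.weight j :=
      Finset.sum_le_sum_of_subset (Finset.range_mono h)
    have h2 := Nat.mul_le_mul_left (P.u - P.l) h1
    have h3 := Nat.mul_le_mul_left P.α hM
    rw [potential, ← hF, mul_comm _ P.α]
    omega
  · have hfull : ∑ e ∈ fullRacks A, rackCount A e = F * P.u := by
      rw [Finset.sum_congr rfl (fun e he => mem_fullRacks.1 he)]; simp [hF]
    have hfullmin : ∑ e ∈ fullRacks A, min (rackCount A e) P.l = F * P.l := by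
      rw [Finset.sum_congr rfl (fun e he => by rw [mem_fullRacks.1 he, min_eq_right hl.le])]
      simp [hF]
    have hsplit := Finset.sum_add_sum_compl (fullRacks A) (rackCount A)
    have hsplitmin := Finset.sum_add_sum_compl (fullRacks A) (fun e => min (rackCount A e) P.l)
    have hX : ∑ e ∈ (fullRacks A)ᶜ, rackCount A e = ∑ e ∈ (fullRacks A)ᶜ, (rackCount A e - P.l) +
        ∑ e ∈ (fullRacks A)ᶜ, min (rackCount A e) P.l := by
      rw [← Finset.sum_add_distrib]
      exact Finset.sum_congr rfl (fun e _ => by omega)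
    have hrange : ∑ j ∈ Finset.range P.dbar, P.weight j ≤
        ∑ j ∈ Finset.range F, P.weight j + (P.kbar - F) * w := by
      rw [← Finset.sum_range_add_sum_Ico _ h.le]
      apply Nat.add_le_add_left
      calc ∑ j ∈ Finset.Ico F P.dbar, P.weight j ≤ ∑ j ∈ Finset.Ico F P.dbar, w :=
            Finset.sum_le_sum (fun j hj => P.weight_anti (Finset.mem_Ico.1 hj).1)
        _ = (P.dbar - F) * w := by simp
        _ ≤ _ := Nat.mul_le_mul_right _ (by omega)
    rw [potential, ← hF]
    have hwα : w ≤ P.α := P.weight_le F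
    -- Subtractions are removed by writing `kbar = F + D + 1`, `u = l + c + 1` and `α = w + b`. Then
    -- `α * M + w * X = b * M + w * (X + M)`, so lower bounds for `M` and for `X + M` suffice.
    obtain ⟨D, hD⟩ := Nat.exists_eq_add_of_lt (h.trans hd)
    obtain ⟨c, hc⟩ := Nat.exists_eq_add_of_lt hl
    obtain ⟨b, hb⟩ := Nat.exists_eq_add_of_le hwα
    have e1 : P.kbar - F = D + 1 := by omega
    have e2 : P.u - P.l = c + 1 := by omega
    rw [e1] at hrange
    rw [e2]
    set X := ∑ e ∈ (fullRacks A)ᶜ, (rackCount A e - P.l)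
    set M := ∑ e ∈ (fullRacks A)ᶜ, min (rackCount A e) P.l
    set G := ∑ j ∈ Finset.range F, P.weight j
    change _ ≤ P.α * _ + w * X + _
    rw [← hsplitmin, hfullmin]
    rw [← hsplitmin, hfullmin, hD] at hM
    set m := min P.u0 P.l
    have hm : m ≤ P.u0 := min_le_left _ _
    have hM' : (D + 1) * P.l + m ≤ M := by linarith
    have hXM : (D + 1) * P.u + P.u0 ≤ X + M := by
      have : P.kbar * P.u = F * P.u + (D + 1) * P.u := by rw [hD]; ring
      omega
    have hXM' : (D + 1) * P.l + m + (D + 1) * (c + 1) ≤ X + M := by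
      have : P.u = P.l + (c + 1) := by omega
      rw [this] at hXM
      linarith
    have t1 := Nat.mul_le_mul_left b hM'
    have t2 := Nat.mul_le_mul_left w hXM'
    have t3 := Nat.mul_le_mul_left (c + 1) hrange
    rw [hD, hb]
    linarith

end Potential

/-! ### Robust linear codes and their repair -/

section LinearCode

variable {P : Params} {F E : Type*} [Field F] [AddCommGroup E] [Module F E]

/-- The span of the vectors that the nodes of `A` store. -/
def stored (φ : P.Node → Fin P.α → E) (A : Finset P.Node) : Submodule F E :=
  A.sup (fun v => Submodule.span F (Set.range (φ v)))

/-- The nodes of the racks in `H`. -/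
def rackNodes (H : Finset (Fin P.nbar)) : Finset P.Node := Finset.univ.filter (fun v => v.1 ∈ H)

theorem stored_union (φ : P.Node → Fin P.α → E) (A A' : Finset P.Node) :
    stored (F := F) φ (A ∪ A') = stored φ A ⊔ stored φ A' := Finset.sup_union

theorem rackNodes_insert (h : Fin P.nbar) (H : Finset (Fin P.nbar)) :
    rackNodes (insert h H) = rackNodes {h} ∪ rackNodes H := by
  ext v
  simp [rackNodes]

theorem stored_update_of_notMem (φ : P.Node → Fin P.α → E) {v : P.Node} (ψ : Fin P.α → E)
    {A : Finset P.Node} (hv : v ∉ A) :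
    stored (F := F) (Function.update φ v ψ) A = stored φ A :=
  Finset.sup_congr rfl fun w hw => by
    rw [Function.update_of_ne (ne_of_mem_of_not_mem hw hv)]

theorem stored_update_insert (φ : P.Node → Fin P.α → E) {v : P.Node} (ψ : Fin P.α → E)
    {A : Finset P.Node} (hv : v ∉ A) :
    stored (F := F) (Function.update φ v ψ) (insert v A) =
      stored φ A ⊔ Submodule.span F (Set.range ψ) := by
  rw [← stored_update_of_notMem φ ψ hv, sup_comm, stored, Finset.sup_insert,
    Function.update_self, stored]

/-- Every set of nodes determines the whole file or at least as much of it as the potential of some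
larger set of nodes. -/
def Robust (F : Type*) {E : Type*} [Field F] [AddCommGroup E] [Module F E]
    (φ : P.Node → Fin P.α → E) : Prop :=
  ∀ A : Finset P.Node, Module.finrank F E ≤ Module.finrank F (stored (F := F) φ A) ∨
    ∃ A', A ⊆ A' ∧ potential A' ≤ Module.finrank F (stored (F := F) φ A)

variable [FiniteDimensional F E]

/-- The racks of `H` upload generic vectors in turn. For a given `A`, the set `H'` collects racks
whose entire contents become computable, and every other rack contributes `b` new dimensions. One
choice of `x` serves all `A`. -/
theorem exists_uploads (hF : (Fintype.card (Finset P.Node) : ℕ∞) < ENat.card F)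
    (φ : P.Node → Fin P.α → E) (b : ℕ) (H : Finset (Fin P.nbar)) :
    ∃ x : Fin P.nbar → Fin b → E, (∀ h ∈ H, ∀ j, x h j ∈ stored (F := F) φ (rackNodes {h})) ∧
      ∀ A, ∃ H' ⊆ H,
        Module.finrank F (stored (F := F) φ (A ∪ rackNodes H')) + (H.card - H'.card) * b ≤
          Module.finrank F (stored (F := F) φ A ⊔
            H.sup (fun h => Submodule.span F (Set.range (x h))) : Submodule F E) := by
  classical
  induction H using Finset.induction_on with
  | empty =>
    refine ⟨fun _ _ => 0, by simp, fun A => ⟨∅, subset_rfl, ?_⟩⟩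
    have he : A ∪ rackNodes ∅ = A := by simp [rackNodes]
    rw [he, Finset.card_empty, Nat.zero_sub, zero_mul, add_zero]
    exact Submodule.finrank_mono le_sup_left
  | insert h H hh ih =>
    obtain ⟨x, hxV, hx⟩ := ih
    obtain ⟨y, hyV, hy⟩ := exists_generic_vectors hF (stored (F := F) φ (rackNodes {h}))
      (fun A => stored (F := F) φ A ⊔ H.sup (fun h => Submodule.span F (Set.range (x h)))) b
    have hsup : H.sup (fun i => Submodule.span F (Set.range (Function.update x h y i))) =
        H.sup (fun i => Submodule.span F (Set.range (x i))) :=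
      Finset.sup_congr rfl fun i hi => by
        rw [Function.update_of_ne (ne_of_mem_of_not_mem hi hh)]
    refine ⟨Function.update x h y, fun i hi j => ?_, fun A => ?_⟩
    · by_cases he : i = h
      · subst he; simpa using hyV j
      · simpa [he] using hxV i (Finset.mem_of_mem_insert_of_ne hi he) j
    · have heq : stored (F := F) φ A ⊔
          (insert h H).sup (fun i => Submodule.span F (Set.range (Function.update x h y i))) =
          (stored φ A ⊔ H.sup (fun i => Submodule.span F (Set.range (x i)))) ⊔
            Submodule.span F (Set.range y) := by
        rw [Finset.sup_insert, hsup, Function.update_self,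
          sup_comm (Submodule.span F (Set.range y)), sup_assoc]
      rw [heq, Finset.card_insert_of_notMem hh]
      rcases hy A with h1 | h1
      · obtain ⟨H', hH', hle⟩ := hx A
        refine ⟨H', hH'.trans (Finset.subset_insert _ _), le_trans ?_ h1⟩
        have hc := Finset.card_le_card hH'
        rw [Nat.succ_sub hc, Nat.succ_mul]
        omega
      -- The whole rack `h` is now in the span, so it may be adjoined to `A` before the other
      -- uploads are counted; this is why the induction treats all `A` at once.
      · obtain ⟨H', hH', hle⟩ := hx (A ∪ rackNodes {h})
        refine ⟨insert h H', Finset.insert_subset_insert h hH', ?_⟩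
        rw [Finset.card_insert_of_notMem (fun hm => hh (hH' hm)), Nat.add_sub_add_right,
          rackNodes_insert, ← Finset.union_assoc]
        refine hle.trans (Submodule.finrank_mono ?_)
        rw [stored_union]
        exact sup_le (sup_le (le_sup_left.trans le_sup_left) h1) (le_sup_right.trans le_sup_left)

/-- Nodes are filled one by one with `α` generic vectors; a new node raises the potential by at most
`α`. -/
theorem exists_robust (hl : P.l < P.u)
    (hF : (Fintype.card (Finset P.Node) : ℕ∞) < ENat.card F) :
    ∃ φ : P.Node → Fin P.α → E, Robust F φ := by
  classical
  suffices h : ∀ S : Finset P.Node, ∃ φ : P.Node → Fin P.α → E, ∀ A ⊆ S,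
      Module.finrank F E ≤ Module.finrank F (stored (F := F) φ A) ∨
        potential A ≤ Module.finrank F (stored (F := F) φ A) by
    obtain ⟨φ, hφ⟩ := h Finset.univ
    exact ⟨φ, fun A => (hφ A (Finset.subset_univ A)).imp_right fun h => ⟨A, subset_rfl, h⟩⟩
  intro S
  induction S using Finset.induction_on with
  | empty =>
    refine ⟨fun _ _ => 0, fun A hA => Or.inr ?_⟩
    rw [Finset.subset_empty.1 hA, potential_empty hl]
    exact Nat.zero_le _
  | insert v S hv ih =>
    obtain ⟨φ, hφ⟩ := ih
    obtain ⟨ψ, -, hψ⟩ := exists_generic_vectors hF ⊤ (fun A => stored (F := F) φ A) P.α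
    refine ⟨Function.update φ v ψ, fun A hA => ?_⟩
    by_cases hvA : v ∈ A
    · have hA0 : A.erase v ⊆ S := Finset.subset_insert_iff.1 hA
      have hpot := potential_insert_le hl (A.erase v) v
      rw [← Finset.insert_erase hvA, stored_update_insert φ ψ (Finset.notMem_erase v A)]
      rcases hψ (A.erase v) with h | h
      · rcases hφ _ hA0 with h' | h'
        · left; omega
        · right; omega
      · left
        rw [top_le_iff.1 h, finrank_top]
    · rw [stored_update_of_notMem φ ψ hvA]
      exact hφ A ((Finset.subset_insert_iff_of_notMem hvA).1 hA)

/-- A robust code can be repaired to a robust code. -/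
theorem Robust.exists_repair (hl : P.l < P.u)
    (hF : (Fintype.card (Finset P.Node) : ℕ∞) < ENat.card F)
    {φ : P.Node → Fin P.α → E} (hφ : Robust F φ) (r : Repair P) :
    ∃ (x : Fin P.nbar → Fin P.β → E) (ψ : Fin P.α → E),
      (∀ h ∈ r.helperRacks, ∀ j, x h j ∈ stored (F := F) φ (rackNodes {h})) ∧
      (∀ j, ψ j ∈ stored (F := F) φ (r.localHelpers.image (fun g => (r.rack, g))) ⊔
        r.helperRacks.sup (fun h => Submodule.span F (Set.range (x h)))) ∧
      Robust F (Function.update φ r.node ψ) := by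
  classical
  obtain ⟨x, hxV, hx⟩ := exists_uploads hF φ P.β r.helperRacks
  set L : Finset P.Node := r.localHelpers.image (fun g => (r.rack, g)) with hL
  obtain ⟨ψ, hψV, hψ⟩ := exists_generic_vectors hF
    (stored φ L ⊔ r.helperRacks.sup (fun h => Submodule.span F (Set.range (x h))))
    (fun A => stored (F := F) φ A) P.α
  refine ⟨x, ψ, hxV, hψV, fun A => ?_⟩
  by_cases hvA : r.node ∈ A
  swap
  · rw [stored_update_of_notMem φ ψ hvA]
    exact hφ A
  have hins := Finset.insert_erase hvA
  rw [← hins, stored_update_insert φ ψ (Finset.notMem_erase _ A)]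
  set A0 := A.erase r.node
  rcases hψ A0 with h | h
  · rcases hφ A0 with h' | ⟨A', hA', h'⟩
    · left; omega
    · have := potential_insert_le hl A' r.node
      exact Or.inr ⟨insert r.node A', Finset.insert_subset_insert _ hA', by omega⟩
  -- Here `A0` and the replacement span all that the replacement could have stored, hence also `L`
  -- and the uploads. The set `A'` given by robustness contains `L` and the racks of `H'`, so adding
  -- the node to it costs at most `(dbar - H'.card) * β`, the gain from the remaining uploads.
  · obtain ⟨H', hH', hle⟩ := hx (A0 ∪ L)
    have hle' := hle.trans (Submodule.finrank_mono (t := stored φ A0 ⊔ Submodule.span F (Set.range ψ))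
      (by
        rw [stored_union, sup_assoc]
        exact sup_le le_sup_left h))
    rw [r.card_helperRacks] at hle'
    rcases hφ (A0 ∪ L ∪ rackNodes H') with h' | ⟨A', hA', h'⟩
    · left; omega
    · refine Or.inr ⟨insert r.node A', Finset.insert_subset_insert _ ?_, ?_⟩
      · exact (Finset.subset_union_left.trans Finset.subset_union_left).trans hA'
      · have hc : P.l ≤ rackCount A' r.node.1 := by
          calc P.l = L.card := by
                rw [hL, Finset.card_image_of_injective _ (fun _ _ h => by simpa using h),
                  r.card_localHelpers]
            _ ≤ _ := by
                apply Finset.card_le_card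
                intro v hv
                rw [Finset.mem_filter]
                refine ⟨hA' (Finset.mem_union_left _ (Finset.mem_union_right _ hv)), ?_⟩
                obtain ⟨g, -, rfl⟩ := Finset.mem_image.1 hv
                rfl
        have hj : H'.card ≤ (fullRacks A').card := by
          apply Finset.card_le_card
          intro h hh
          exact mem_fullRacks_of_forall fun g => hA' (Finset.mem_union_right _ (by
            simpa [rackNodes] using hh))
        have := potential_insert_le_of_helpers hl A' r.node hc hj
        omega

theorem Robust.stored_eq_top (hl : P.l < P.u) (hd : P.dbar < P.kbar)
    (hE : Module.finrank F E = P.fileSize) {φ : P.Node → Fin P.α → E} (hφ : Robust F φ)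
    {K : Finset P.Node} (hK : K.card = P.k) : stored (F := F) φ K = ⊤ := by
  apply Submodule.eq_top_of_finrank_eq
  apply le_antisymm (Submodule.finrank_le _)
  rcases hφ K with h | ⟨A', hA', h⟩
  · exact h
  · have := fileSize_le_potential hl hd (hK.symm.le.trans (Finset.card_le_card hA'))
    omega

end LinearCode

/-! ### From spans of functionals to coding functions -/

section Functional

variable {P : Params} {F M : Type*} [Field F] [AddCommGroup M] [Module F M]

/-- Two files on which the functionals in `S` agree cannot be told apart by `S`; with
`exists_factor` this turns membership in a span into a decoding, upload or repair function. -/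
theorem eq_of_mem_span {S : Submodule F (Module.Dual F M)} {m m' : M}
    (hS : S ≤ LinearMap.ker (Module.Dual.eval F M (m - m'))) {x : Module.Dual F M} (hx : x ∈ S) :
    x m = x m' := by
  have := hS hx
  rwa [LinearMap.mem_ker, Module.Dual.eval_apply, map_sub, sub_eq_zero] at this

theorem span_le_ker_eval {ι : Type*} {x : ι → Module.Dual F M} {m m' : M}
    (h : ∀ j, x j m = x j m') :
    Submodule.span F (Set.range x) ≤ LinearMap.ker (Module.Dual.eval F M (m - m')) := by
  rw [Submodule.span_le]
  rintro _ ⟨j, rfl⟩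
  rw [SetLike.mem_coe, LinearMap.mem_ker, Module.Dual.eval_apply, map_sub, h, sub_self]

theorem stored_le_ker_eval {φ : P.Node → Fin P.α → Module.Dual F M} {A : Finset P.Node} {m m' : M}
    (h : ∀ v ∈ A, ∀ j, φ v j m = φ v j m') :
    stored φ A ≤ LinearMap.ker (Module.Dual.eval F M (m - m')) :=
  Finset.sup_le fun v hv => span_le_ker_eval (h v hv)

end Functional

theorem exists_factor {α β γ : Type*} [Nonempty γ] (f : α → β) (g : α → γ)
    (h : ∀ a b, f a = f b → g a = g b) : ∃ e : β → γ, ∀ a, e (f a) = g a := by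
  obtain ⟨e, he⟩ := (Function.factorsThrough_iff (f := f) g).1 fun a b => h a b
  exact ⟨e, fun a => (congrFun he a).symm⟩

theorem attainableOnline_fileSize (P : Params) (hl : P.l < P.u) (hd : P.dbar < P.kbar) :
    AttainableOnline P P.fileSize := by
  classical
  -- Generic choices avoid one subspace for each set of nodes, a number that does not depend on the
  -- length of the history; so one field suffices forever.
  obtain ⟨p, hp, hprime⟩ := Nat.exists_infinite_primes (Fintype.card (Finset P.Node) + 1)
  have : Fact p.Prime := ⟨hprime⟩
  have hF : (Fintype.card (Finset P.Node) : ℕ∞) < ENat.card (ZMod p) := by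
    rw [ENat.card_eq_coe_fintype_card, ZMod.card]
    exact_mod_cast hp
  have hE : Module.finrank (ZMod p) (Module.Dual (ZMod p) (Fin P.fileSize → ZMod p)) =
      P.fileSize := by
    rw [Subspace.dual_finrank_eq, Module.finrank_fin_fun]
  refine ⟨ZMod p, inferInstance, inferInstance,
    {s | ∃ φ : P.Node → Fin P.α → Module.Dual (ZMod p) (Fin P.fileSize → ZMod p),
      Robust (ZMod p) φ ∧ s = fun v m j => φ v j m}, ?_, ?_, ?_⟩
  · obtain ⟨φ, hφ⟩ := exists_robust (E := Module.Dual (ZMod p) (Fin P.fileSize → ZMod p)) hl hF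
    exact ⟨_, φ, hφ, rfl⟩
  · rintro _ ⟨φ, hφ, rfl⟩ K hK
    apply exists_factor (fun (m : Fin P.fileSize → ZMod p) (v : K) j => φ v j m) id
    intro m m' h
    rw [id, id, ← sub_eq_zero, ← Module.forall_dual_apply_eq_zero_iff (ZMod p)]
    intro x
    rw [map_sub, sub_eq_zero]
    have hx : x ∈ stored (F := ZMod p) φ K := by
      rw [hφ.stored_eq_top hl hd hE hK]; trivial
    exact eq_of_mem_span
      (stored_le_ker_eval fun v hv j => congrFun (congrFun h ⟨v, hv⟩) j) hx
  · rintro _ ⟨φ, hφ, rfl⟩ r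
    obtain ⟨x, ψ, hx, hψ, hrob⟩ := hφ.exists_repair hl hF r
    refine ⟨_, ⟨_, hrob, rfl⟩, fun v hv => ?_, ?_⟩
    · funext m j
      dsimp only
      rw [Function.update_of_ne hv]
    · have hup : ∀ h : r.helperRacks, ∃ up : (Fin P.u → Fin P.α → ZMod p) → (Fin P.β → ZMod p),
          ∀ m, up (fun g j => φ (h, g) j m) = fun j => x h j m := by
        intro h
        apply exists_factor (fun (m : Fin P.fileSize → ZMod p) (g : Fin P.u) (j : Fin P.α) =>
          φ (h, g) j m) (fun m j => x h j m)
        intro m m' hm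
        funext j
        refine eq_of_mem_span (stored_le_ker_eval ?_) (hx h h.2 j)
        rintro ⟨e, g⟩ hv i
        have he : e = h := by simpa [rackNodes] using hv
        subst he
        exact congrFun (congrFun hm g) i
      choose up hup using hup
      obtain ⟨gen, hgen⟩ := exists_factor
        (fun m : Fin P.fileSize → ZMod p =>
          ((fun (g : r.localHelpers) (j : Fin P.α) => φ (r.rack, g) j m,
            fun (h : r.helperRacks) (j : Fin P.β) => x h j m) :
            (r.localHelpers → Fin P.α → ZMod p) × (r.helperRacks → Fin P.β → ZMod p)))
        (fun m j => ψ j m) (by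
          intro m m' hm
          rw [Prod.mk.injEq] at hm
          funext j
          refine eq_of_mem_span (sup_le (stored_le_ker_eval ?_)
            (Finset.sup_le fun h hh => span_le_ker_eval fun j => ?_)) (hψ j)
          · intro v hv i
            obtain ⟨g, hg, rfl⟩ := Finset.mem_image.1 hv
            exact congrFun (congrFun hm.1 ⟨g, hg⟩) i
          · exact congrFun (congrFun hm.2 ⟨h, hh⟩) j)
      refine ⟨up, fun a b => gen (a, b), fun m => ?_⟩
      simp only [hup, Function.update_self]
      exact (hgen m).symm

/-- The online answers are iterated along the given history. -/
theorem AttainableOnline.offline {P : Params} {B : ℕ} (h : AttainableOnline P B) :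
    AttainableOffline P B := by
  obtain ⟨A, hfin, hnt, S, ⟨s0, hs0⟩, hret, hstep⟩ := h
  intro T r
  refine ⟨A, hfin, hnt, ?_⟩
  choose! next hnext hrep using hstep
  let s : (n : ℕ) → n ≤ T → {s // s ∈ S} := fun n => Nat.rec (fun _ => ⟨s0, hs0⟩)
    (fun n ih hn => ⟨next (ih (by omega)).1 (r ⟨n, by omega⟩), hnext _ (ih (by omega)).2 _⟩) n
  refine ⟨fun t => (s t (by omega)).1, fun t => hret _ (s t _).2, fun t => ?_⟩
  exact hrep _ (s t _).2 (r t)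

/-! ### Cuts bound the file size -/

section Cut

variable {P : Params} {T : ℕ} (r : Fin T → Repair P)

/-- The only edges with finite nonzero capacity are those that store and those that upload. -/
theorem capacity_cases (a b : Vertex P T) :
    capacity r a b = 0 ∨ capacity r a b = ⊤ ∨ (∃ v, a = .origIn v ∧ b = .out 0 v) ∨
      (∃ t, a = .newIn t ∧ b = .out t.succ (r t).node) ∨
      ∃ t, ∃ h ∈ (r t).helperRacks, a = .gate t h ∧ b = .newIn t := by
  cases a <;> cases b <;> simp only [capacity, true_or, or_true] <;> split_ifs with h <;>
    first
    | exact Or.inl rfl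
    | exact Or.inr (Or.inl rfl)
    | skip
  · obtain ⟨rfl, rfl⟩ := h
    exact Or.inr (Or.inr (Or.inl ⟨_, rfl, rfl⟩))
  · obtain ⟨rfl, rfl⟩ := h
    exact Or.inr (Or.inr (Or.inr (Or.inl ⟨_, rfl, rfl⟩)))
  · obtain ⟨rfl, h⟩ := h
    exact Or.inr (Or.inr (Or.inr (Or.inr ⟨_, _, h, rfl, rfl⟩)))

/-- The original nodes whose storage edge leaves `W`. -/
def cutOrig (W : Finset (Vertex P T)) : Finset P.Node :=
  Finset.univ.filter (fun v => Vertex.origIn v ∈ W ∧ Vertex.out 0 v ∉ W)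

/-- The repairs for which the storage edge of the new node leaves `W`. -/
def cutNew (W : Finset (Vertex P T)) : Finset (Fin T) :=
  Finset.univ.filter (fun t => Vertex.newIn t ∈ W ∧ Vertex.out t.succ (r t).node ∉ W)

/-- The uploads that leave `W`. -/
def cutUpload (W : Finset (Vertex P T)) : Finset (Fin T × Fin P.nbar) :=
  Finset.univ.filter (fun p => p.2 ∈ (r p.1).helperRacks ∧
    Vertex.gate p.1 p.2 ∈ W ∧ Vertex.newIn p.1 ∉ W)

/-- The value of a cut that no edge of infinite capacity crosses. -/
theorem sum_capacity_eq (W : Finset (Vertex P T))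
    (hW : ∀ a ∈ W, ∀ b ∉ W, capacity r a b ≠ ⊤) :
    ∑ a ∈ W, ∑ b ∈ Wᶜ, capacity r a b =
      ((cutOrig W).card * P.α + (cutNew r W).card * P.α + (cutUpload r W).card * P.β : ℕ) := by
  let edge : P.Node ⊕ Fin T ⊕ (Fin T × Fin P.nbar) → Vertex P T × Vertex P T :=
    Sum.elim (fun v => (.origIn v, .out 0 v)) (Sum.elim (fun t => (.newIn t, .out t.succ (r t).node))
      (fun p => (.gate p.1 p.2, .newIn p.1)))
  have hinj : Function.Injective edge := by
    rintro (v | t | ⟨t, h⟩) (v' | t' | ⟨t', h'⟩) heq <;> simp [edge] at heq ⊢ <;> tauto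
  rw [← Finset.sum_product',
    ← Finset.sum_subset (s₁ := ((cutOrig W).disjSum
      ((cutNew r W).disjSum (cutUpload r W))).image edge)]
  · rw [Finset.sum_image (fun _ _ _ _ h => hinj h), Finset.sum_disjSum, Finset.sum_disjSum,
      Finset.sum_congr (s₁ := cutOrig W) (g := fun _ => (P.α : ℕ∞)) rfl
        (fun v _ => by simp [edge, capacity]),
      Finset.sum_congr (s₁ := cutNew r W) (g := fun _ => (P.α : ℕ∞)) rfl
        (fun v _ => by simp [edge, capacity]),
      Finset.sum_congr (s₁ := cutUpload r W) (g := fun _ => (P.β : ℕ∞)) rfl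
        (fun p hp => by simp [edge, capacity, (Finset.mem_filter.1 hp).2.1])]
    simp [add_assoc]
  · intro p hp
    obtain ⟨i, hi, rfl⟩ := Finset.mem_image.1 hp
    rcases i with v | t | ⟨t, h⟩ <;>
      simp [edge, cutOrig, cutNew, cutUpload] at hi ⊢ <;> tauto
  · rintro ⟨a, b⟩ hp hne
    rw [Finset.mem_product, Finset.mem_compl] at hp
    rcases capacity_cases r a b with h | h | ⟨v, rfl, rfl⟩ | ⟨t, rfl, rfl⟩ | ⟨t, h, hh, rfl, rfl⟩
    · exact h
    · exact absurd h (hW a hp.1 b hp.2)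
    · refine absurd (Finset.mem_image.2 ⟨Sum.inl v, ?_, rfl⟩) hne
      simpa [cutOrig] using hp
    · refine absurd (Finset.mem_image.2 ⟨Sum.inr (Sum.inl t), ?_, rfl⟩) hne
      simpa [cutNew] using hp
    · refine absurd (Finset.mem_image.2 ⟨Sum.inr (Sum.inr (t, h)), ?_, rfl⟩) hne
      simpa [cutUpload, hh] using hp

/-- Files that can be stored are not larger than any cut. -/
theorem le_minCut_of_repairStep {A : Type} [Finite A] [Nontrivial A] {B : ℕ}
    (s : Fin (T + 1) → Contents P A B) (hret : ∀ t, Retrievable (s t))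
    (hstep : ∀ t : Fin T, RepairStep (s t.castSucc) (r t) (s t.succ))
    (t : Fin (T + 1)) (K : Finset P.Node) (hK : K.card = P.k) :
    (B : ℕ∞) ≤ minCut (capacity r) Vertex.source (Vertex.collector t K) := by
  rw [minCut, le_iInf₂_iff]
  rintro W ⟨hsource, hcoll⟩
  by_cases hW : ∀ a ∈ W, ∀ b ∉ W, capacity r a b ≠ ⊤
  swap
  · push Not at hW
    obtain ⟨a, ha, b, hb, hab⟩ := hW
    calc (B : ℕ∞) ≤ ⊤ := le_top
      _ = capacity r a b := hab.symm
      _ ≤ ∑ b ∈ Wᶜ, capacity r a b :=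
        Finset.single_le_sum (f := fun b => capacity r a b) (fun _ _ => zero_le)
          (Finset.mem_compl.2 hb)
      _ ≤ _ := Finset.single_le_sum (f := fun a => ∑ b ∈ Wᶜ, capacity r a b)
          (fun _ _ => zero_le) ha
  rw [sum_capacity_eq r W hW, Nat.cast_le]
  -- Whatever feeds the sink side through an infinite edge lies on the sink side itself.
  have hin : ∀ {a b}, b ∉ W → capacity r a b = ⊤ → a ∉ W := fun hb h ha => hW _ ha _ hb h
  choose hkeep upload gen hgen using hstep
  -- The symbols carried by the finite edges across the cut; the file will be recovered from them by
  -- following the history.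
  let msg : (Fin B → A) → (cutOrig W → Fin P.α → A) × (cutNew r W → Fin P.α → A) ×
      (cutUpload r W → Fin P.β → A) := fun m =>
    (fun v => s 0 v m, fun i => s i.1.succ (r i).node m,
      fun p => upload p.1.1 ⟨p.1.2, (Finset.mem_filter.1 p.2).2.1⟩
        (fun g => s p.1.1.castSucc (p.1.2, g) m))
  have hinj : Function.Injective msg := by
    intro m m' hm
    simp only [msg, Prod.mk.injEq] at hm
    obtain ⟨h1, h2, h3⟩ := hm
    have key : ∀ (i : Fin (T + 1)) (v : P.Node), Vertex.out i v ∉ W → s i v m = s i v m' := by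
      intro i
      induction i using Fin.induction with
      | zero =>
        intro v hv
        have hv' : Vertex.origIn v ∈ W := by
          by_contra hn
          exact hin hn (a := .source) rfl hsource
        exact congrFun h1 ⟨v, by simp [cutOrig, hv, hv']⟩
      | succ i ih =>
        intro v hv
        by_cases hvi : v = (r i).node
        · subst hvi
          by_cases hnew : Vertex.newIn i ∈ W
          · exact congrFun h2 ⟨i, by simp [cutNew, hv, hnew]⟩
          · rw [hgen, hgen]
            congr 1
            · funext g
              refine ih _ (hin hnew ?_)
              simp [capacity]
            · funext h
              by_cases hgate : Vertex.gate i h.1 ∈ W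
              · exact congrFun h3 ⟨(i, h), by simp [cutUpload, hgate, hnew]⟩
              · congr 1
                funext g
                refine ih _ (hin hgate ?_)
                simp [capacity]
        · rw [hkeep i v hvi]
          exact ih v (hin hv (if_pos ⟨i, rfl, rfl, rfl, hvi⟩))
    obtain ⟨dec, hdec⟩ := hret t K hK
    rw [← hdec m, ← hdec m']
    congr 1
    funext v
    refine key t v (hin hcoll ?_)
    simp [capacity]
  have hcard := Nat.card_le_card_of_injective msg hinj
  simp only [Nat.card_fun, Nat.card_prod, Nat.card_eq_fintype_card, Fintype.card_fin,
    Fintype.card_coe, ← pow_mul, ← pow_add] at hcard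
  have := (Nat.pow_le_pow_iff_right Finite.one_lt_card).1 hcard
  linarith

theorem AttainableOffline.le_of_mem_minCuts {B : ℕ} (h : AttainableOffline P B) {c : ℕ∞}
    (hc : c ∈ minCuts P) : (B : ℕ∞) ≤ c := by
  obtain ⟨T, r, t, K, hK, rfl⟩ := hc
  obtain ⟨A, _, _, s, hret, hstep⟩ := h T r
  exact le_minCut_of_repairStep r s hret hstep t K hK

end Cut

/-! ### A history with a small cut -/

section WorstCase

variable {P : Params}

theorem kbar_le_nbar (hk : P.k ≤ P.nbar * P.u) : P.kbar ≤ P.nbar :=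
  Nat.div_le_of_le_mul (by rwa [mul_comm])

/-- The repairs of all nodes `(e, g)` with `l ≤ g`, rack by rack. As many of the preceding racks as
possible help. -/
def worstRepair (P : Params) (hd : P.dbar < P.nbar) (t : Fin (P.nbar * (P.u - P.l))) :
    Repair P where
  rack := t.divNat
  pos := ⟨P.l + t.modNat, by omega⟩
  localHelpers := Finset.univ.filter (fun g => g.val < P.l)
  -- Rack `e ≤ dbar` is helped by the other racks up to `dbar`, and a later rack by racks `0` to
  -- `dbar - 1`; the `min` covers both cases.
  helperRacks := (Finset.univ.filter (fun h : Fin P.nbar => h.val < P.dbar + 1)).erase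
    ⟨min t.divNat P.dbar, by omega⟩
  pos_notMem := by simp
  card_localHelpers := by
    rw [Fin.card_filter_val_lt]
    have := t.modNat.2
    omega
  rack_notMem := by
    simp only [Finset.mem_erase, Finset.mem_filter, Finset.mem_univ, true_and, ne_eq, Fin.ext_iff,
      not_and]
    omega
  card_helperRacks := by
    rw [Finset.card_erase_of_mem (by simp), Fin.card_filter_val_lt]
    omega

/-- The first `k` nodes. -/
def firstNodes (P : Params) : Finset P.Node :=
  Finset.univ.filter (fun v => v.1.val * P.u + v.2 < P.k)

theorem card_firstNodes (hk : P.k ≤ P.nbar * P.u) : (firstNodes P).card = P.k := by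
  calc (firstNodes P).card
      = (Finset.univ.filter (fun i : Fin (P.nbar * P.u) => i.val < P.k)).card := by
        refine Finset.card_equiv finProdFinEquiv fun v => ?_
        simp [firstNodes, add_comm, mul_comm]
    _ = P.k := by rw [Fin.card_filter_val_lt, min_eq_right hk]

/-- The number of repairs before the repair of the node `v` in `worstRepair`. -/
def worstTime (v : P.Node) : ℕ := v.1 * (P.u - P.l) + (v.2 - P.l)

theorem worstTime_lt_of_lt {v : P.Node} {e : ℕ} (he : v.1.val < e) (hv : P.l ≤ v.2.val) :
    worstTime v < e * (P.u - P.l) := by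
  have h := Nat.mul_le_mul_right (P.u - P.l) (Nat.succ_le_of_lt he)
  have := v.2.2
  rw [Nat.succ_mul] at h
  rw [worstTime]
  omega

theorem divNat_mul_le {m n : ℕ} (t : Fin (m * n)) : t.divNat * n ≤ t.val := by
  rw [Fin.coe_divNat]
  exact Nat.div_mul_le_self _ _

theorem eq_node_of_worstTime_eq (hd : P.dbar < P.nbar) {v : P.Node} (hv : P.l ≤ v.2.val)
    {t : Fin (P.nbar * (P.u - P.l))} (h : worstTime v = t.val) :
    v = (worstRepair P hd t).node := by
  have h2 := v.2.2
  have hpos : 0 < P.u - P.l := by omega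
  rw [worstTime] at h
  refine Prod.ext (Fin.ext ?_) (Fin.ext ?_)
  · change v.1.val = t.divNat.val
    rw [Fin.coe_divNat, ← h, mul_comm, Nat.mul_add_div hpos, Nat.div_eq_of_lt (by omega), add_zero]
  · change v.2.val = P.l + t.modNat.val
    rw [Fin.coe_modNat, ← h, mul_comm, Nat.mul_add_mod, Nat.mod_eq_of_lt (by omega)]
    omega

/-- The vertices on the side of the data collector in a minimum cut for `worstRepair`. -/
def worstSink (hd : P.dbar < P.nbar) : Vertex P (P.nbar * (P.u - P.l)) → Prop
  | .source => False
  | .origIn _ => False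
  -- The cheaper side is cut: the uploads if they cost less than `α`, otherwise the storage edge.
  | .newIn t => (worstRepair P hd t).node ∈ firstNodes P ∧ (P.dbar - t.divNat) * P.β < P.α
  | .out t v => v ∈ firstNodes P ∧ (v.2.val < P.l ∨ worstTime v < t)
  | .gate t h => (worstRepair P hd t).node ∈ firstNodes P ∧ h < t.divNat
  | .collector t K => t = Fin.last _ ∧ K = firstNodes P

theorem mem_firstNodes {v : P.Node} : v ∈ firstNodes P ↔ v.1.val * P.u + v.2 < P.k := by
  simp [firstNodes]

theorem mem_firstNodes_of_lt {v w : P.Node} (hw : w ∈ firstNodes P) (h : v.1 < w.1) :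
    v ∈ firstNodes P := by
  rw [mem_firstNodes] at *
  have h1 := Nat.mul_le_mul_right P.u (Nat.succ_le_of_lt (Fin.lt_def.1 h))
  have := v.2.2
  rw [Nat.succ_mul] at h1
  omega

/-- No edge of infinite capacity enters the sink side. -/
theorem capacity_worstRepair_ne_top (hd : P.dbar < P.nbar)
    {a b : Vertex P (P.nbar * (P.u - P.l))} (ha : ¬ worstSink hd a) (hb : worstSink hd b) :
    capacity (worstRepair P hd) a b ≠ ⊤ := by
  intro h
  have hα : (P.α : ℕ∞) ≠ ⊤ := ENat.natCast_ne_top _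
  have hβ : (P.β : ℕ∞) ≠ ⊤ := ENat.natCast_ne_top _
  cases a <;> cases b <;> simp only [capacity] at h <;> try (first | exact hb | simp at h; done)
  · split_ifs at h <;> try exact ENat.zero_ne_top h
    exact hα h
  · split_ifs at h <;> try exact ENat.zero_ne_top h
    exact hα h
  · rename_i t w t'
    split_ifs at h with hc <;> try exact ENat.zero_ne_top h
    obtain ⟨rfl, hr, hw⟩ := hc
    have hwl : w.2.val < P.l := by simpa [worstRepair] using hw
    refine ha ⟨?_, Or.inl hwl⟩
    have := mem_firstNodes.1 hb.1
    rw [mem_firstNodes, hr]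
    have hpos : (worstRepair P hd t').node.2.val = P.l + t'.modNat := rfl
    change (worstRepair P hd t').node.1.val * P.u + w.2 < P.k
    omega
  · rename_i t w t' w'
    split_ifs at h with hc <;> try exact ENat.zero_ne_top h
    obtain ⟨i, rfl, rfl, rfl, hne⟩ := hc
    refine ha ⟨hb.1, ?_⟩
    rcases lt_or_ge w'.2.val P.l with hl | hl
    · exact Or.inl hl
    · have hlt := hb.2.resolve_left (by omega)
      -- A node is not copied at the step that replaces it, so a node already replaced after step
      -- `i` was replaced before it.
      have : worstTime w' ≠ i.val := fun he => hne (eq_node_of_worstTime_eq hd hl he)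
      right
      rw [Fin.val_succ] at hlt
      rw [Fin.val_castSucc]
      omega
  · rename_i t w t' h'
    split_ifs at h with hc <;> try exact ENat.zero_ne_top h
    obtain ⟨rfl, -, rfl⟩ := hc
    refine ha ⟨mem_firstNodes_of_lt hb.1 hb.2, ?_⟩
    rcases lt_or_ge w.2.val P.l with hl | hl
    · exact Or.inl hl
    · exact Or.inr ((worstTime_lt_of_lt (Fin.lt_def.1 hb.2) hl).trans_le (divNat_mul_le t'))
  · rename_i t w t' K
    split_ifs at h with hc <;> try exact ENat.zero_ne_top h
    obtain ⟨rfl, hw⟩ := hc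
    obtain ⟨rfl, rfl⟩ := hb
    refine ha ⟨hw, ?_⟩
    rcases lt_or_ge w.2.val P.l with hl | hl
    · exact Or.inl hl
    · exact Or.inr (worstTime_lt_of_lt w.1.2 hl)
  · split_ifs at h <;> try exact ENat.zero_ne_top h
    exact hβ h

open Classical in
/-- A minimum cut for `worstRepair`. -/
noncomputable def worstCut (hd : P.dbar < P.nbar) : Finset (Vertex P (P.nbar * (P.u - P.l))) :=
  Finset.univ.filter (fun a => ¬ worstSink hd a)

theorem mem_worstCut (hd : P.dbar < P.nbar) {a : Vertex P (P.nbar * (P.u - P.l))} :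
    a ∈ worstCut hd ↔ ¬ worstSink hd a := by simp [worstCut]

/-- At time zero the sink side holds only nodes at positions below `l`, which are never replaced:
`l` in each of the first `kbar` racks and `min u0 l` in the next. -/
theorem card_cutOrig_worstCut (hl : P.l < P.u) (hd : P.dbar < P.nbar) :
    (cutOrig (worstCut hd)).card ≤ P.kbar * P.l + min P.u0 P.l := by
  rw [← Finset.card_range (P.kbar * P.l + min P.u0 P.l)]
  have hmem : ∀ v ∈ cutOrig (worstCut hd), v ∈ firstNodes P ∧ v.2.val < P.l := by
    intro v hv
    have h := (Finset.mem_filter.1 hv).2.2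
    rw [mem_worstCut, not_not] at h
    exact ⟨h.1, h.2.resolve_right (by simp)⟩
  refine Finset.card_le_card_of_injOn (fun v => v.1.val * P.l + v.2.val) ?_ ?_
  · intro v hv
    obtain ⟨hv, hvl⟩ := hmem v hv
    rw [mem_firstNodes] at hv
    have hk := kbar_mul_add_u0 P
    have hu0 := u0_lt hl
    rw [Finset.mem_coe, Finset.mem_range]
    dsimp only
    rcases lt_trichotomy v.1.val P.kbar with h | h | h
    · have := Nat.mul_le_mul_right P.l (Nat.succ_le_of_lt h)
      rw [Nat.succ_mul] at this
      omega
    · rw [h] at hv ⊢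
      omega
    · have := Nat.mul_le_mul_right P.u (Nat.succ_le_of_lt h)
      rw [Nat.succ_mul] at this
      omega
  · intro v hv w hw h
    have hvl := (hmem v hv).2
    have hwl := (hmem w hw).2
    have hpos : 0 < P.l := by omega
    dsimp only at h
    have h1 : v.1.val = w.1.val := by
      have := congrArg (· / P.l) h
      simpa [mul_comm _ P.l, Nat.mul_add_div hpos, Nat.div_eq_of_lt hvl, Nat.div_eq_of_lt hwl]
        using this
    rw [h1] at h
    exact Prod.ext (Fin.ext h1) (Fin.ext (by omega))

/-- Uploads from racks before `e = t.divNat` stay on the sink side; the other helpers have indices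
in `(e, dbar]`. -/
theorem card_cutUpload_fiber_le (hd : P.dbar < P.nbar) (t : Fin (P.nbar * (P.u - P.l))) :
    ((cutUpload (worstRepair P hd) (worstCut hd)).filter (fun p => p.1 = t)).card ≤
      P.dbar - t.divNat := by
  refine le_trans ?_ (Nat.card_Ioc t.divNat.val P.dbar).le
  refine Finset.card_le_card_of_injOn (fun p => p.2.val) ?_ ?_
  · rintro ⟨t', h⟩ hp
    rw [Finset.mem_coe, Finset.mem_filter] at hp
    obtain ⟨hp, rfl⟩ := hp
    obtain ⟨-, hh, hgate, hnew⟩ := Finset.mem_filter.1 hp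
    rw [mem_worstCut] at hgate hnew
    rw [not_not] at hnew
    have hge : ¬ h.val < t'.divNat.val := fun hlt => hgate ⟨hnew.1, Fin.lt_def.2 hlt⟩
    simp only [worstRepair, Finset.mem_erase, Finset.mem_filter, Finset.mem_univ, true_and, ne_eq,
      Fin.ext_iff] at hh
    simp only [Finset.coe_Ioc, Set.mem_Ioc]
    omega
  · rintro ⟨t', h⟩ hp ⟨t'', h'⟩ hp' heq
    simp only [Finset.mem_coe, Finset.mem_filter] at hp hp' heq
    rw [hp.2, hp'.2, Fin.ext heq]

theorem worst_repair_cost_le (hd : P.dbar < P.nbar) (t : Fin (P.nbar * (P.u - P.l))) :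
    (if t ∈ cutNew (worstRepair P hd) (worstCut hd) then P.α else 0) +
      ((cutUpload (worstRepair P hd) (worstCut hd)).filter (fun p => p.1 = t)).card * P.β ≤
      P.weight t.divNat := by
  have hfib := Nat.mul_le_mul_right P.β (card_cutUpload_fiber_le hd t)
  by_cases hs : worstSink hd (.newIn t)
  · rw [if_neg (fun h => (mem_worstCut hd).1 (Finset.mem_filter.1 h).2.1 hs), zero_add]
    exact le_min (hfib.trans hs.2.le) hfib
  · have hempty : (cutUpload (worstRepair P hd) (worstCut hd)).filter (fun p => p.1 = t) = ∅ := by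
      rw [Finset.filter_eq_empty_iff]
      rintro ⟨t', h⟩ hp rfl
      exact (Finset.mem_filter.1 hp).2.2.2 ((mem_worstCut hd).2 hs)
    rw [hempty, Finset.card_empty, zero_mul, add_zero]
    split_ifs with h
    · have hout := (Finset.mem_filter.1 h).2.2
      rw [mem_worstCut, not_not] at hout
      exact le_min le_rfl (not_lt.1 fun hlt => hs ⟨hout.1, hlt⟩)
    · exact Nat.zero_le _

/-- Each rack has `u - l` repairs, and racks from `dbar` on have weight zero since all their helpers
precede them. -/
theorem sum_weight_le (hd : P.dbar < P.nbar) :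
    ∑ t : Fin (P.nbar * (P.u - P.l)), P.weight t.divNat ≤
      (P.u - P.l) * ∑ j ∈ Finset.range P.dbar, P.weight j := by
  have h1 : ∑ t : Fin (P.nbar * (P.u - P.l)), P.weight t.divNat =
      ∑ p : Fin P.nbar × Fin (P.u - P.l), P.weight p.1 :=
    Fintype.sum_equiv finProdFinEquiv.symm _ _ fun t => rfl
  rw [h1, Fintype.sum_prod_type]
  simp only [Finset.sum_const, Finset.card_univ, Fintype.card_fin, smul_eq_mul]
  rw [← Finset.mul_sum, Fin.sum_univ_eq_sum_range P.weight,
    ← Finset.sum_range_add_sum_Ico P.weight hd.le, Finset.sum_eq_zero (s := Finset.Ico _ _), add_zero]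
  intro j hj
  rw [Params.weight, Nat.sub_eq_zero_of_le (Finset.mem_Ico.1 hj).1, zero_mul]
  exact Nat.min_zero _

/-- Some data collector has a cut of at most the maximum file size. -/
theorem exists_mem_minCuts_le (hl : P.l < P.u) (hk : P.k ≤ P.nbar * P.u)
    (hd : P.dbar < P.kbar) : ∃ c ∈ minCuts P, c ≤ (P.fileSize : ℕ∞) := by
  have hd' := hd.trans_le (kbar_le_nbar hk)
  refine ⟨_, ⟨_, worstRepair P hd', Fin.last _, firstNodes P, card_firstNodes hk, rfl⟩, ?_⟩
  refine (iInf₂_le (worstCut hd') ⟨(mem_worstCut hd').2 fun h => h,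
    fun h => (mem_worstCut hd').1 h ⟨rfl, rfl⟩⟩).trans ?_
  rw [sum_capacity_eq _ _ fun a ha b hb => capacity_worstRepair_ne_top hd' ((mem_worstCut hd').1 ha)
    (by rwa [mem_worstCut, not_not] at hb), Nat.cast_le, Params.fileSize, sum_Icc_eq_sum_weight]
  have h1 := Nat.mul_le_mul_right P.α (card_cutOrig_worstCut hl hd')
  have h2 : (cutNew (worstRepair P hd') (worstCut hd')).card * P.α +
      (cutUpload (worstRepair P hd') (worstCut hd')).card * P.β ≤
      ∑ t : Fin (P.nbar * (P.u - P.l)), P.weight t.divNat := by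
    refine le_trans (le_of_eq ?_) (Finset.sum_le_sum fun t _ => worst_repair_cost_le hd' t)
    rw [Finset.sum_add_distrib, ← Finset.sum_mul, Finset.sum_ite_mem, Finset.univ_inter,
      Finset.sum_const, smul_eq_mul]
    congr 2
    exact Finset.card_eq_sum_card_fiberwise (by simp)
  have h3 := h2.trans (sum_weight_le hd')
  omega

end WorstCase

end RackStorage

theorem theorem1 (P : RackStorage.Params)
    (hl : P.l < P.u) (hk : P.k ≤ P.nbar * P.u) (hd : P.dbar < P.kbar)
    (Bstar : ℕ)
    (hBstar : Bstar = (P.kbar * P.l + min P.u0 P.l) * P.α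
      + (P.u - P.l) * ∑ i ∈ Finset.Icc 1 P.dbar, min (i * P.β) P.α) :
    IsGreatest {B : ℕ | RackStorage.AttainableOffline P B} Bstar ∧
    IsGreatest {B : ℕ | RackStorage.AttainableOnline P B} Bstar ∧
    IsLeast (RackStorage.minCuts P) (Bstar : ℕ∞) := by
  have hB : Bstar = P.fileSize := hBstar
  subst hB
  have hon := RackStorage.attainableOnline_fileSize P hl hd
  obtain ⟨c, hc, hle⟩ := RackStorage.exists_mem_minCuts_le hl hk hd
  have hup : ∀ B, RackStorage.AttainableOffline P B → B ≤ P.fileSize := fun B h => by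
    exact_mod_cast (h.le_of_mem_minCuts hc).trans hle
  refine ⟨⟨hon.offline, fun B h => hup B h⟩, ⟨hon, fun B h => hup B h.offline⟩, ?_,
    fun c h => hon.offline.le_of_mem_minCuts h⟩
  rwa [← le_antisymm hle (hon.offline.le_of_mem_minCuts hc)]
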